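/- Let $K$ be a compact Hausdorff space and let $d : K\times K\to[0,+\infty)$ be a metric on $K$ that is lower semicontinuous as a function on the topological product $K \times K$ (the topology generated by $d$ need not be the topology of $K$). Say that $K$ is *fragmented* by $d$ if for every nonempty $A\subset K$ and every $\varepsilon>0$ there is an open set $U\subset K$ with $A\cap U\neq\emptyset$ and $d\text{-}\mathrm{diam}(A\cap U)<\varepsilon$. Let $C(K)$ be the Banach space of real continuous functions on $K$ with the supremum norm; a linear subspace $X\subset C(K)$ is called *Lipschitz* if every $f\in X$ is Lipschitz with respect to $d$. Then the following statements are equivalent: (i) $K$ is not fragmented by $d$; (ii) $C(K)$ contains an isometric Lipschitz copy of $\ell_1$, that is, a Lipschitz subspace linearly isometric to $\ell_1$; (iii) $C(K)$ contains an isomorphic Lipschitz copy of $\ell_1$, that is, a Lipschitz subspace linearly homeomorphic to $\ell_1$. Here $\ell_1$ is the real Banach space of absolutely summable sequences with its usual norm. -/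

import Mathlib

open scoped ENNReal

/-- `d` is a (finite, real-valued) metric on the set `K`. It is kept as a plain function, since `K`
carries a topology of its own which is in general not the one generated by `d`. -/
structure IsMetricOn {K : Type*} (d : K → K → ℝ) : Prop where
  nonneg : ∀ x y, 0 ≤ d x y
  eq_zero_iff : ∀ x y, d x y = 0 ↔ x = y
  symm : ∀ x y, d x y = d y x
  triangle : ∀ x y z, d x z ≤ d x y + d y z

/-- The diameter of `A` with respect to `d`, with value `∞` when `A` is `d`-unbounded. -/
noncomputable def diamOf {K : Type*} (d : K → K → ℝ) (A : Set K) : ℝ≥0∞ :=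
  ⨆ x ∈ A, ⨆ y ∈ A, ENNReal.ofReal (d x y)

/-- `K` is fragmented by `d`: every nonempty subset of `K` has nonempty relatively open subsets of
arbitrarily small `d`-diameter. -/
def FragmentedBy (K : Type*) [TopologicalSpace K] (d : K → K → ℝ) : Prop :=
  ∀ A : Set K, A.Nonempty → ∀ ε : ℝ, 0 < ε →
    ∃ U : Set K, IsOpen U ∧ (A ∩ U).Nonempty ∧ diamOf d (A ∩ U) < ENNReal.ofReal ε

/-- `f` is a Lipschitz function with respect to `d`. -/
def IsLipschitzFor {K : Type*} (d : K → K → ℝ) (f : K → ℝ) : Prop :=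
  ∃ C : ℝ, ∀ s t, |f s - f t| ≤ C * d s t

/-- A linear subspace of `C(K)` is Lipschitz if all its elements are `d`-Lipschitz functions. -/
def IsLipschitzSubspace {K : Type*} [TopologicalSpace K] (d : K → K → ℝ)
    (X : Submodule ℝ C(K, ℝ)) : Prop :=
  ∀ f ∈ X, IsLipschitzFor d f

/-- `C(K)` (with the supremum norm) contains an isometric Lipschitz copy of `E`: a Lipschitz subspace
which is linearly isometric to `E`. -/
def ContainsIsometricLipschitzCopy (K : Type*) [TopologicalSpace K] [CompactSpace K]
    (d : K → K → ℝ) (E : Type*) [NormedAddCommGroup E] [NormedSpace ℝ E] : Prop :=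
  ∃ X : Submodule ℝ C(K, ℝ), IsLipschitzSubspace d X ∧ Nonempty (E ≃ₗᵢ[ℝ] X)

/-- `C(K)` (with the supremum norm) contains an isomorphic Lipschitz copy of `E`: a Lipschitz subspace
which is linearly homeomorphic to `E`. -/
def ContainsIsomorphicLipschitzCopy (K : Type*) [TopologicalSpace K] [CompactSpace K]
    (d : K → K → ℝ) (E : Type*) [NormedAddCommGroup E] [NormedSpace ℝ E] : Prop :=
  ∃ X : Submodule ℝ C(K, ℝ), IsLipschitzSubspace d X ∧ Nonempty (E ≃L[ℝ] X)

/-- The Banach space `ℓ₁` of absolutely summable real sequences. -/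
abbrev EllOne : Type := lp (fun _ : ℕ => ℝ) 1

/-! If `K` is not fragmented, some `A` and `ε` make every nonempty relatively open piece of `A` have
diameter at least `ε`. Lower semicontinuity turns two distant points of a piece into open sets with
`d`-separated closures, so a dyadic tree grows. At each level the nodes with last digit `false` and
those with last digit `true` form closed sets more than `ε / 2` apart. A Lipschitz Urysohn lemma
(`exists_continuous_lipschitz_separating`) gives equi-Lipschitz `f n` equal to `-1` and `1` there.
By compactness every branch has a limit point, so all sign patterns occur and `a ↦ ∑ a n • f n` is
isometric on `ℓ₁`.

Conversely, by Banach–Steinhaus a Lipschitz copy of `ℓ₁` has an equi-Lipschitz basis. If `K` is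
fragmented, such a sequence is uniformly approximated on a countable set of points
(`FragmentedBy.exists_countable_net_of_pos`), so a subsequence converges pointwise. Differences of
its consecutive terms are bounded and pointwise null, hence weakly null by dominated convergence;
yet a functional on `ℓ₁` equals `1` on all of them. -/

open Set Filter Topology

/-- The open sets `A` and `B` satisfy `d x y > a` for all `x ∈ closure A` and `y ∉ B`. -/
def WellInside {K : Type*} [TopologicalSpace K] (d : K → K → ℝ) (a : ℝ) (A B : Set K) : Prop :=
  ∀ x ∈ closure A, ∀ y ∉ B, a < d x y

/-! ### Urysohn functions that are also `d`-Lipschitz -/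

section Urysohn

variable {K : Type*} [TopologicalSpace K] {d : K → K → ℝ}

theorem WellInside.closure_subset (hd : IsMetricOn d) {a : ℝ} (ha : 0 ≤ a) {A B : Set K}
    (h : WellInside d a A B) : closure A ⊆ B := by
  intro x hx
  by_contra hxB
  have := h x hx x hxB
  rw [(hd.eq_zero_iff x x).2 rfl] at this
  linarith

/-- A chain of open sets, consecutive ones being `a`-well inside each other. -/
def IsOpenChain (d : K → K → ℝ) (a : ℝ) (S : ℕ → Set K) : Prop :=
  ∀ k, IsOpen (S k) ∧ WellInside d a (S k) (S (k + 1))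

theorem IsOpenChain.monotone (hd : IsMetricOn d) {a : ℝ} (ha : 0 ≤ a) {S : ℕ → Set K}
    (h : IsOpenChain d a S) : Monotone S :=
  monotone_nat_of_le_succ fun k => subset_closure.trans ((h k).2.closure_subset hd ha)

variable [CompactSpace K] [T2Space K]

/-- By lower semicontinuity this is the projection of a closed, hence compact, subset of `K × K`. -/
theorem isClosed_closedThickening (hlsc : LowerSemicontinuous (fun p : K × K => d p.1 p.2))
    {F : Set K} (hF : IsClosed F) (r : ℝ) : IsClosed {x | ∃ z ∈ F, d z x ≤ r} := by
  have h1 : IsClosed {p : K × K | p.1 ∈ F ∧ d p.1 p.2 ≤ r} :=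
    (hF.preimage continuous_fst).inter (hlsc.isClosed_preimage r)
  convert (h1.isCompact.image continuous_snd).isClosed using 1
  ext x
  simp

/-- By the triangle inequality the `a`-thickening of `F` and the `b`-thickening of `G` are disjoint;
normality separates them. -/
theorem exists_isOpen_between (hd : IsMetricOn d)
    (hlsc : LowerSemicontinuous (fun p : K × K => d p.1 p.2)) {F G : Set K}
    (hF : IsClosed F) (hG : IsClosed G) {a b : ℝ} (h : ∀ x ∈ F, ∀ y ∈ G, a + b < d x y) :
    ∃ V : Set K, IsOpen V ∧ (∀ x ∈ F, ∀ y ∉ V, a < d x y) ∧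
      ∀ x ∈ closure V, ∀ y ∈ G, b < d x y := by
  have hF' := isClosed_closedThickening hlsc hF a
  have hG' := isClosed_closedThickening hlsc hG b
  have hdisj : Disjoint {x | ∃ z ∈ F, d z x ≤ a} {x | ∃ z ∈ G, d z x ≤ b} := by
    rw [Set.disjoint_left]
    rintro x ⟨y, hy, hyx⟩ ⟨z, hz, hzx⟩
    have h1 := hd.triangle y x z
    have h2 := h y hy z hz
    have h3 := hd.symm x z
    linarith
  obtain ⟨V, hV, hFV, hVG⟩ := normal_exists_closure_subset hF' hG'.isOpen_compl
    hdisj.subset_compl_right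
  refine ⟨V, hV, fun x hx y hy => ?_, fun x hx y hy => ?_⟩
  · by_contra hc
    exact hy (hFV ⟨x, hx, not_lt.1 hc⟩)
  · by_contra hc
    exact hVG hx ⟨y, hy, by rw [hd.symm]; exact not_lt.1 hc⟩

theorem WellInside.exists_between (hd : IsMetricOn d)
    (hlsc : LowerSemicontinuous (fun p : K × K => d p.1 p.2)) {a : ℝ} {A B : Set K}
    (hB : IsOpen B) (h : WellInside d a A B) :
    ∃ V, IsOpen V ∧ WellInside d (a / 2) A V ∧ WellInside d (a / 2) V B :=
  exists_isOpen_between hd hlsc isClosed_closure hB.isClosed_compl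
    (a := a / 2) (b := a / 2) fun x hx y hy => by simpa using h x hx y hy

theorem IsOpenChain.exists_refinement (hd : IsMetricOn d)
    (hlsc : LowerSemicontinuous (fun p : K × K => d p.1 p.2)) {a : ℝ} {S : ℕ → Set K}
    (h : IsOpenChain d a S) : ∃ S', IsOpenChain d (a / 2) S' ∧ ∀ k, S' (2 * k) = S k := by
  choose V hV hSV hVS using fun k => (h k).2.exists_between hd hlsc (h (k + 1)).1
  refine ⟨fun k => if Even k then S (k / 2) else V (k / 2), fun k => ?_, fun k => by simp⟩
  rcases Nat.even_or_odd' k with ⟨m, rfl | rfl⟩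
  · have : (2 * m + 1) / 2 = m := by omega
    simpa [this] using ⟨(h m).1, hSV m⟩
  · have h1 : (2 * m + 1) / 2 = m := by omega
    have h2 : (2 * m + 1 + 1) / 2 = m + 1 := by omega
    have h3 : Even (2 * m + 1 + 1) := ⟨m + 1, by ring⟩
    have h4 : ¬ Even (2 * m + 1) := by simp
    simp only [h1, h2, h3, h4, if_true, if_false]
    exact ⟨hV m, hVS m⟩

/-- `S n k` is the Urysohn set of index `k / 2 ^ n`; the last clause makes it depend on that number
only. -/
theorem IsOpenChain.exists_dyadic (hd : IsMetricOn d)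
    (hlsc : LowerSemicontinuous (fun p : K × K => d p.1 p.2)) {a : ℝ} {S₀ : ℕ → Set K}
    (h : IsOpenChain d a S₀) : ∃ S : ℕ → ℕ → Set K, S 0 = S₀ ∧
      (∀ n, IsOpenChain d (a / 2 ^ n) (S n)) ∧ ∀ m n k, S (n + m) (2 ^ m * k) = S n k := by
  choose! R hR hR' using fun (b : ℝ) (S : ℕ → Set K) (hS : IsOpenChain d b S) =>
    hS.exists_refinement hd hlsc
  let S : ℕ → ℕ → Set K := fun n => Nat.rec S₀ (fun n T => R (a / 2 ^ n) T) n
  have hS : ∀ n, IsOpenChain d (a / 2 ^ n) (S n) := by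
    intro n
    induction n with
    | zero => simpa [S] using h
    | succ n ih =>
      have := hR _ _ ih
      rwa [div_div, ← pow_succ] at this
  refine ⟨S, rfl, hS, fun m n k => ?_⟩
  induction m generalizing k with
  | zero => simp
  | succ m ih =>
    have := hR' _ _ (hS (n + m)) (2 ^ m * k)
    rw [← ih, ← this, pow_succ', mul_assoc]
    rfl

/-- A Urysohn lemma with Lipschitz control: closed sets at positive `d`-distance are separated by a
continuous function which is also `d`-Lipschitz. -/
theorem exists_continuous_lipschitz_separating (hd : IsMetricOn d)
    (hlsc : LowerSemicontinuous (fun p : K × K => d p.1 p.2)) {F G : Set K}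
    (hF : IsClosed F) (hG : IsClosed G) {a : ℝ} (ha : 0 < a)
    (h : ∀ x ∈ F, ∀ y ∈ G, a < d x y) :
    ∃ f : C(K, ℝ), (∀ x, f x ∈ Icc (0 : ℝ) 1) ∧ (∀ x ∈ F, f x = 0) ∧ (∀ x ∈ G, f x = 1) ∧
      ∀ x y, |f x - f y| ≤ 4 / a * d x y := by
  -- With `a := 0` none of the gap is spent: `closure U` still lies at distance more than `a` from
  -- `G`.
  obtain ⟨U, hU, hFU, hUG⟩ := exists_isOpen_between hd hlsc hF hG (a := 0) (b := a)
    (by simpa using h)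
  have hFU' : F ⊆ U := by
    intro x hx
    by_contra hxU
    have := hFU x hx x hxU
    rw [(hd.eq_zero_iff x x).2 rfl] at this
    exact lt_irrefl _ this
  obtain ⟨S, hS0, hS, hSS⟩ := IsOpenChain.exists_dyadic hd hlsc (d := d) (a := a)
    (S₀ := fun k => match k with | 0 => U | 1 => Gᶜ | _ => univ) (by
      intro k
      match k with
      | 0 => exact ⟨hU, fun x hx y hy => hUG x hx y (not_not.1 hy)⟩
      | 1 => exact ⟨hG.isOpen_compl, fun x _ y hy => absurd (mem_univ y) hy⟩
      | k + 2 => exact ⟨isOpen_univ, fun x _ y hy => absurd (mem_univ y) hy⟩)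
  have hapos : ∀ n : ℕ, 0 < a / 2 ^ n := fun n => by positivity
  have hmono : ∀ n, Monotone (S n) := fun n => (hS n).monotone hd (hapos n).le
  have hle : ∀ {n k m j : ℕ}, (k : ℝ) / 2 ^ n ≤ j / 2 ^ m → S n k ⊆ S m j := by
    intro n k m j hkj
    rw [← hSS m n k, ← hSS n m j, add_comm m n]
    apply hmono
    rw [div_le_div_iff₀ (by positivity) (by positivity)] at hkj
    have : k * 2 ^ m ≤ j * 2 ^ n := by exact_mod_cast hkj
    linarith
  let D : K → Set ℝ := fun x => {r | ∃ n k : ℕ, r = k / 2 ^ n ∧ x ∈ S n k}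
  let f : K → ℝ := fun x => sInf (D x)
  have hbdd : ∀ x, BddBelow (D x) := fun x => ⟨0, by rintro _ ⟨n, k, rfl, -⟩; positivity⟩
  have hne : ∀ x, (D x).Nonempty := fun x => ⟨2, 0, 2, by simp, by simp [hS0]⟩
  have hf0 : ∀ x, 0 ≤ f x := fun x => le_csInf (hne x) (by rintro _ ⟨n, k, rfl, -⟩; positivity)
  have hfle : ∀ {x n k}, x ∈ S n k → f x ≤ k / 2 ^ n := fun {x n k} hx =>
    csInf_le (hbdd x) ⟨n, k, rfl, hx⟩
  have hflt : ∀ {x} {n k : ℕ}, f x < k / 2 ^ n → x ∈ S n k := by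
    intro x n k hx
    obtain ⟨_, ⟨m, j, rfl, hj⟩, hlt⟩ := exists_lt_of_csInf_lt (hne x) hx
    exact hle hlt.le hj
  -- A `d`-step of at most `a / 2 ^ n` leads from `S n (k + 1)` at worst into the next set of the
  -- chain.
  have hstep : ∀ n x y, d x y ≤ a / 2 ^ n → f y ≤ f x + 2 / 2 ^ n := by
    intro n x y hxy
    have hp : (0 : ℝ) < 2 ^ n := by positivity
    have h1 := Nat.lt_floor_add_one (f x * 2 ^ n)
    have h2 := Nat.floor_le (mul_nonneg (hf0 x) hp.le)
    set k := ⌊f x * 2 ^ n⌋₊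
    have hx : x ∈ S n (k + 1) := hflt (by rw [lt_div_iff₀ hp]; exact_mod_cast h1)
    have hy : y ∈ S n (k + 1 + 1) := by
      by_contra hc
      exact absurd ((hS n (k + 1)).2 x (subset_closure hx) y hc) (not_lt.2 hxy)
    refine (hfle hy).trans ?_
    rw [div_le_iff₀ hp, add_mul, div_mul_cancel₀ _ hp.ne']
    push_cast
    linarith
  have hlip : ∀ x y, min (f y) 1 ≤ min (f x) 1 + 4 / a * d x y := by
    intro x y
    rcases eq_or_ne x y with rfl | hxy
    · simpa using mul_nonneg (by positivity : 0 ≤ 4 / a) (hd.nonneg x x)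
    have hpos : 0 < d x y := lt_of_le_of_ne (hd.nonneg x y)
      fun h0 => hxy ((hd.eq_zero_iff x y).1 h0.symm)
    have hx1 : 0 ≤ min (f x) 1 := le_min (hf0 x) zero_le_one
    by_cases hda : a < d x y
    · have : 1 ≤ 4 / a * d x y := by
        rw [div_mul_eq_mul_div, le_div_iff₀ ha]; linarith
      have := min_le_right (f y) 1
      linarith
    -- With `a / 2 ^ (n + 1) < d x y ≤ a / 2 ^ n`, the increment `2 / 2 ^ n` is below `4 / a * d x
    -- y`.
    · obtain ⟨n, hn1, hn2⟩ := exists_nat_pow_near (x := a / d x y) (y := 2)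
        ((one_le_div hpos).2 (not_lt.1 hda)) one_lt_two
      have hp : (0 : ℝ) < 2 ^ n := by positivity
      have h1 : d x y ≤ a / 2 ^ n := by
        rw [le_div_iff₀ hpos] at hn1
        rw [le_div_iff₀ hp]; linarith
      have h2 : 2 / 2 ^ n ≤ 4 / a * d x y := by
        rw [div_lt_iff₀ hpos, pow_succ] at hn2
        rw [div_mul_eq_mul_div, div_le_div_iff₀ hp ha]; linarith
      have h3 := hstep n x y h1
      have h4 : 0 ≤ 4 / a * d x y := by positivity
      rcases le_total (f x) 1 with h5 | h5
      · rw [min_eq_left h5]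
        exact (min_le_left _ _).trans (by linarith)
      · rw [min_eq_right h5]
        exact (min_le_right _ _).trans (by linarith)
  have hcont : Continuous f := by
    rw [continuous_iff_lower_upperSemicontinuous]
    constructor
    · intro x c hc
      -- Two dyadic steps must fit between `c` and `f x`: one to exceed `c`, one because the closure
      -- of a set lies only in its successor.
      obtain ⟨n, hn⟩ := exists_pow_lt_of_lt_one (half_pos (sub_pos.2 hc)) (one_half_lt_one (α := ℝ))
      have hp : (0 : ℝ) < 2 ^ n := by positivity
      have hn' : 2 < (f x - c) * 2 ^ n := by
        rw [one_div, inv_pow, inv_lt_iff_one_lt_mul₀ hp] at hn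
        linarith
      rcases lt_or_ge c 0 with hc0 | hc0
      · exact Eventually.of_forall fun y => hc0.trans_le (hf0 y)
      have h1 := Nat.lt_floor_add_one (c * 2 ^ n)
      have h2 := Nat.floor_le (mul_nonneg hc0 hp.le)
      set k := ⌊c * 2 ^ n⌋₊
      have hxk : x ∉ closure (S n (k + 1)) := by
        intro hx
        have h3 := hfle ((hS n (k + 1)).2.closure_subset hd (hapos n).le hx)
        rw [le_div_iff₀ hp] at h3
        push_cast at h3
        linarith
      filter_upwards [isClosed_closure.isOpen_compl.mem_nhds hxk] with y hy
      have h4 : ((k + 1 : ℕ) : ℝ) / 2 ^ n ≤ f y := by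
        by_contra hc
        exact hy (subset_closure (hflt (not_le.1 hc)))
      refine lt_of_lt_of_le ?_ h4
      rw [lt_div_iff₀ hp]
      exact_mod_cast h1
    · intro x c hc
      obtain ⟨_, ⟨n, k, rfl, hk⟩, hlt⟩ := exists_lt_of_csInf_lt (hne x) hc
      filter_upwards [(hS n k).1.mem_nhds hk] with y hy
      exact (hfle hy).trans_lt hlt
  refine ⟨⟨fun x => min (f x) 1, hcont.min continuous_const⟩,
    fun x => ⟨le_min (hf0 x) zero_le_one, min_le_right _ _⟩, fun x hx => ?_, fun x hx => ?_,
    fun x y => ?_⟩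
  · have : f x ≤ 0 := by
      have hx0 : x ∈ S 0 0 := by rw [hS0]; exact hFU' hx
      simpa using hfle hx0
    simp [le_antisymm this (hf0 x)]
  · have : 1 ≤ f x := by
      by_contra hc
      have : x ∈ S 0 1 := hflt (by simpa using hc)
      rw [hS0] at this
      exact this hx
    simp [this]
  · rw [abs_sub_le_iff]
    have h1 := hlip x y
    have h2 := hlip y x
    rw [hd.symm y x] at h2
    constructor <;> simp only [ContinuousMap.coe_mk] <;> linarith

end Urysohn

/-! ### Operators on `ℓ₁` defined by bounded sequences -/

section EllOne

variable {E : Type*} [NormedAddCommGroup E] [NormedSpace ℝ E]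

theorem EllOne.hasSum_abs (a : EllOne) : HasSum (fun n => |a n|) ‖a‖ := by
  simpa using lp.hasSum_norm (p := 1) (by simp) a

theorem EllOne.summable_smul [CompleteSpace E] {v : ℕ → E} (hv : ∀ n, ‖v n‖ ≤ 1) (a : EllOne) :
    Summable fun n => a n • v n := by
  refine Summable.of_norm_bounded (EllOne.hasSum_abs a).summable fun n => ?_
  rw [norm_smul, Real.norm_eq_abs]
  exact mul_le_of_le_one_right (abs_nonneg _) (hv n)

/-- The operator `a ↦ ∑ aₙ vₙ` on `ℓ₁` given by a sequence `v` in the unit ball. -/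
noncomputable def EllOne.sumCLM [CompleteSpace E] (v : ℕ → E) (hv : ∀ n, ‖v n‖ ≤ 1) :
    EllOne →L[ℝ] E :=
  LinearMap.mkContinuous
    { toFun := fun a => ∑' n, a n • v n
      map_add' := fun a b => by
        simp only [lp.coeFn_add, Pi.add_apply, add_smul]
        exact (summable_smul hv a).tsum_add (summable_smul hv b)
      map_smul' := fun c a => by
        simp only [lp.coeFn_smul, Pi.smul_apply, smul_assoc, RingHom.id_apply]
        exact (summable_smul hv a).tsum_const_smul c } 1 fun a => by
    rw [one_mul]
    refine tsum_of_norm_bounded (EllOne.hasSum_abs a) fun n => ?_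
    rw [norm_smul, Real.norm_eq_abs]
    exact mul_le_of_le_one_right (abs_nonneg _) (hv n)

theorem EllOne.hasSum_sumCLM [CompleteSpace E] {v : ℕ → E} (hv : ∀ n, ‖v n‖ ≤ 1) (a : EllOne) :
    HasSum (fun n => a n • v n) (EllOne.sumCLM v hv a) :=
  (summable_smul hv a).hasSum

theorem EllOne.norm_sumCLM_le [CompleteSpace E] {v : ℕ → E} (hv : ∀ n, ‖v n‖ ≤ 1) (a : EllOne) :
    ‖EllOne.sumCLM v hv a‖ ≤ ‖a‖ := by
  simpa using (EllOne.sumCLM v hv).le_of_opNorm_le (LinearMap.mkContinuous_norm_le _ zero_le_one _) a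

theorem EllOne.sumCLM_single [CompleteSpace E] {v : ℕ → E} (hv : ∀ n, ‖v n‖ ≤ 1) (k : ℕ) :
    EllOne.sumCLM v hv (lp.single 1 k (1 : ℝ)) = v k := by
  refine (hasSum_sumCLM hv _).unique ?_
  convert hasSum_single (f := fun n => (lp.single 1 k (1 : ℝ) : EllOne) n • v n) k
    (fun n hn => by simp [hn]) using 1
  simp

end EllOne

/-! ### From non-fragmentability to an isometric copy of `ℓ₁` -/

section NotFragmented

variable {K : Type*} [TopologicalSpace K] [CompactSpace K] [T2Space K] {d : K → K → ℝ}

/-- The set `a < d` is open in `K × K`, so two points of `A ∩ U` in this relation have product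
neighbourhoods inside it; regularity shrinks these to closed ones. -/
theorem exists_split_of_le_diamOf
    (hlsc : LowerSemicontinuous (fun p : K × K => d p.1 p.2)) {A : Set K} {a : ℝ}
    (ha : 0 ≤ a)
    (hA : ∀ U, IsOpen U → (A ∩ U).Nonempty → ENNReal.ofReal a < diamOf d (A ∩ U))
    {U : Set K} (hU : IsOpen U) (hAU : (A ∩ U).Nonempty) :
    ∃ V : Bool → Set K, (∀ b, IsOpen (V b) ∧ (A ∩ V b).Nonempty ∧ closure (V b) ⊆ U) ∧
      ∀ x ∈ closure (V true), ∀ y ∈ closure (V false), a < d x y := by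
  have h := hA U hU hAU
  simp only [diamOf, lt_iSup_iff] at h
  obtain ⟨x, hx, y, hy, hxy⟩ := h
  have hxy' : a < d x y := (ENNReal.ofReal_lt_ofReal_iff_of_nonneg ha).1 hxy
  have hnhds : {p : K × K | a < d p.1 p.2} ∈ 𝓝 (x, y) := hlsc (x, y) a hxy'
  rw [nhds_prod_eq, mem_prod_iff] at hnhds
  obtain ⟨P, hP, Q, hQ, hPQ⟩ := hnhds
  have key : ∀ z ∈ A ∩ U, ∀ P ∈ 𝓝 z, ∃ V, IsOpen V ∧ (A ∩ V).Nonempty ∧ closure V ⊆ U ∧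
      closure V ⊆ P := by
    intro z hz P hP
    obtain ⟨W, hW, hWc, hWP⟩ := exists_mem_nhds_isClosed_subset
      (inter_mem (hU.mem_nhds hz.2) hP)
    have hcl : closure (interior W) ⊆ U ∩ P :=
      (closure_minimal interior_subset hWc).trans hWP
    exact ⟨interior W, isOpen_interior, ⟨z, hz.1, mem_interior_iff_mem_nhds.2 hW⟩,
      hcl.trans inter_subset_left, hcl.trans inter_subset_right⟩
  obtain ⟨V, hV, hAV, hVU, hVP⟩ := key x hx P hP
  obtain ⟨W, hW, hAW, hWU, hWQ⟩ := key y hy Q hQ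
  refine ⟨fun b => if b then V else W, ?_, fun u hu v hv => ?_⟩
  · rintro (_ | _)
    · exact ⟨hW, hAW, hWU⟩
    · exact ⟨hV, hAV, hVU⟩
  · exact @hPQ (u, v) ⟨hVP (by simpa using hu), hWQ (by simpa using hv)⟩

/-- A dyadic tree of open sets with uniformly `d`-separated branches. -/
theorem exists_separated_scheme
    (hlsc : LowerSemicontinuous (fun p : K × K => d p.1 p.2)) (hsymm : ∀ x y, d x y = d y x)
    {A : Set K} (hAne : A.Nonempty) {a : ℝ} (ha : 0 ≤ a)
    (hA : ∀ U, IsOpen U → (A ∩ U).Nonempty → ENNReal.ofReal a < diamOf d (A ∩ U)) :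
    ∃ V : List Bool → Set K, (∀ s, (V s).Nonempty) ∧ (∀ b s, closure (V (b :: s)) ⊆ V s) ∧
      ∀ s t, s.length = t.length → s ≠ t →
        ∀ x ∈ closure (V s), ∀ y ∈ closure (V t), a < d x y := by
  choose! W hW hWsep using fun (U : Set K) (h : IsOpen U ∧ (A ∩ U).Nonempty) =>
    exists_split_of_le_diamOf hlsc ha hA h.1 h.2
  let V : List Bool → Set K := fun s => List.rec univ (fun b _ U => W U b) s
  have hV : ∀ s, IsOpen (V s) ∧ (A ∩ V s).Nonempty := by
    intro s
    induction s with
    | nil => exact ⟨isOpen_univ, by simpa [V] using hAne⟩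
    | cons b s ih => exact ⟨(hW _ ih b).1, (hW _ ih b).2.1⟩
  have hsub : ∀ b s, closure (V (b :: s)) ⊆ V s := fun b s => (hW _ (hV s) b).2.2
  refine ⟨V, fun s => (hV s).2.mono inter_subset_right, hsub, fun s => ?_⟩
  induction s with
  | nil =>
    intro t ht hne
    exact absurd (List.eq_nil_of_length_eq_zero ht.symm).symm hne
  | cons b s ih =>
    intro t ht hne x hx y hy
    match t, ht, hne with
    | c :: t, ht, hne =>
      by_cases hst : s = t
      · subst hst
        have hsep := hWsep _ (hV s)
        match b, c, hne with
        | true, true, hne => exact absurd rfl hne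
        | false, false, hne => exact absurd rfl hne
        | true, false, _ => exact hsep x hx y hy
        | false, true, _ =>
          rw [hsymm]
          exact hsep y hy x hx
      -- Nodes with different parents inherit the separation of the parents.
      · exact ih t (by simpa using ht) hst x (subset_closure (hsub b s hx)) y
          (subset_closure (hsub c t hy))

/-- A sequence of continuous functions realizing all sign patterns. -/
theorem exists_lipschitz_signs_of_not_fragmentedBy (hd : IsMetricOn d)
    (hlsc : LowerSemicontinuous (fun p : K × K => d p.1 p.2)) (h : ¬ FragmentedBy K d) :
    ∃ (f : ℕ → C(K, ℝ)) (C : ℝ), (∀ n, ‖f n‖ ≤ 1) ∧ (∀ n x y, |f n x - f n y| ≤ C * d x y) ∧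
      ∀ θ : ℕ → Bool, ∃ x, ∀ n, f n x = if θ n then 1 else -1 := by
  simp only [FragmentedBy, not_forall, not_exists, not_and, not_lt] at h
  obtain ⟨A, hAne, ε, hε, hA⟩ := h
  obtain ⟨V, hVne, hVsub, hVsep⟩ := exists_separated_scheme (d := d) hlsc hd.symm hAne
    (half_pos hε).le fun U hU hAU =>
      ((ENNReal.ofReal_lt_ofReal_iff hε).2 (half_lt_self hε)).trans_le (hA U hU hAU)
  -- The head of a list is the latest choice, so `F b n` collects the nodes of level `n + 1` whose
  -- last digit is `b`.
  let F : Bool → ℕ → Set K := fun b n => ⋃ s ∈ {s : List Bool | s.length = n}, closure (V (b :: s))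
  have hF : ∀ b n, IsClosed (F b n) := fun b n =>
    (List.finite_length_eq Bool n).isClosed_biUnion fun _ _ => isClosed_closure
  have hFF : ∀ n, ∀ x ∈ F false n, ∀ y ∈ F true n, ε / 2 < d x y := by
    intro n x hx y hy
    simp only [F, mem_iUnion, mem_ofPred_eq] at hx hy
    obtain ⟨s, hs, hx⟩ := hx
    obtain ⟨t, ht, hy⟩ := hy
    exact hVsep _ _ (by simp [hs, ht]) (by simp) x hx y hy
  choose g hg01 hg0 hg1 hglip using fun n =>
    exists_continuous_lipschitz_separating hd hlsc (hF false n) (hF true n) (half_pos hε) (hFF n)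
  refine ⟨fun n => (2 : ℝ) • g n - 1, 2 * (4 / (ε / 2)), fun n => ?_, fun n x y => ?_, fun θ => ?_⟩
  · rw [ContinuousMap.norm_le _ zero_le_one]
    intro x
    have := hg01 n x
    rw [Real.norm_eq_abs, abs_le]
    simp only [ContinuousMap.sub_apply, ContinuousMap.smul_apply, smul_eq_mul,
      ContinuousMap.one_apply]
    constructor <;> linarith [this.1, this.2]
  · simp only [ContinuousMap.sub_apply, ContinuousMap.smul_apply, smul_eq_mul,
      ContinuousMap.one_apply]
    rw [show 2 * g n x - 1 - (2 * g n y - 1) = 2 * (g n x - g n y) by ring, abs_mul, abs_two,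
      mul_assoc]
    exact mul_le_mul_of_nonneg_left (hglip n x y) zero_le_two
  · let s : ℕ → List Bool := fun n => Nat.rec [] (fun n l => θ n :: l) n
    have hs : ∀ n, (s n).length = n := fun n => by
      induction n with
      | zero => rfl
      | succ n ih => exact congrArg (· + 1) ih
    obtain ⟨x, hx⟩ := IsCompact.nonempty_iInter_of_sequence_nonempty_isCompact_isClosed
      (fun n => closure (V (s n))) (fun n => (hVsub (θ n) (s n)).trans subset_closure)
      (fun n => (hVne _).closure) isClosed_closure.isCompact fun n => isClosed_closure
    refine ⟨x, fun n => ?_⟩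
    have hxn : x ∈ F (θ n) n := mem_biUnion (hs n) (mem_iInter.1 hx (n + 1))
    simp only [ContinuousMap.sub_apply, ContinuousMap.smul_apply, smul_eq_mul,
      ContinuousMap.one_apply]
    cases hθ : θ n
    · rw [hθ] at hxn
      simp [hg0 n x hxn]
    · rw [hθ] at hxn
      simp [hg1 n x hxn]
      norm_num

/-- At a point realizing the signs of `a`, the sum `∑ a n • f n` takes the value `‖a‖`. -/
theorem containsIsometricLipschitzCopy_of_not_fragmentedBy (hd : IsMetricOn d)
    (hlsc : LowerSemicontinuous (fun p : K × K => d p.1 p.2)) (h : ¬ FragmentedBy K d) :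
    ContainsIsometricLipschitzCopy K d EllOne := by
  obtain ⟨f, C, hf1, hflip, hsign⟩ := exists_lipschitz_signs_of_not_fragmentedBy hd hlsc h
  have happly : ∀ (a : EllOne) x, HasSum (fun n => a n * f n x) (EllOne.sumCLM f hf1 a x) :=
    fun a x => (EllOne.hasSum_sumCLM hf1 a).mapL (ContinuousMap.evalCLM ℝ x)
  have hnorm : ∀ a, ‖EllOne.sumCLM f hf1 a‖ = ‖a‖ := by
    intro a
    refine le_antisymm (EllOne.norm_sumCLM_le hf1 a) ?_
    obtain ⟨x, hx⟩ := hsign fun n => decide (0 ≤ a n)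
    have h1 : EllOne.sumCLM f hf1 a x = ‖a‖ := by
      refine (happly a x).unique ?_
      convert EllOne.hasSum_abs a using 2 with n
      rw [hx]
      by_cases h0 : 0 ≤ a n
      · simp [h0, abs_of_nonneg h0]
      · simp [h0, abs_of_neg (not_le.1 h0)]
    rw [← h1]
    exact (le_abs_self _).trans ((EllOne.sumCLM f hf1 a).norm_coe_le_norm x)
  let T : EllOne →ₗᵢ[ℝ] C(K, ℝ) := ⟨(EllOne.sumCLM f hf1).toLinearMap, hnorm⟩
  refine ⟨LinearMap.range T.toLinearMap, ?_, ⟨T.equivRange⟩⟩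
  rintro _ ⟨a, rfl⟩
  refine ⟨‖a‖ * C, fun x y => ?_⟩
  have h1 := (happly a x).sub (happly a y)
  rw [mul_assoc]
  refine h1.norm_le_of_bounded ((EllOne.hasSum_abs a).mul_right _) fun n => ?_
  rw [← mul_sub, norm_mul]
  exact mul_le_mul_of_nonneg_left (hflip n x y) (abs_nonneg _)

end NotFragmented

/-! ### From an isomorphic copy of `ℓ₁` to non-fragmentability -/

section Fragmented

open MeasureTheory

/-- An operator all of whose values are `d`-Lipschitz is uniformly so on the unit ball. -/
theorem exists_uniform_lipschitz_constant {K : Type*} [TopologicalSpace K] {d : K → K → ℝ}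
    {E : Type*} [NormedAddCommGroup E] [NormedSpace ℝ E]
    [CompleteSpace E] (hd : IsMetricOn d) (T : E →L[ℝ] C(K, ℝ))
    (hT : ∀ a, IsLipschitzFor d (T a)) :
    ∃ C : ℝ, 0 < C ∧ ∀ a x y, |T a x - T a y| ≤ C * ‖a‖ * d x y := by
  -- Difference quotients as functionals, bounded at each `a` because `T a` is Lipschitz; on the
  -- diagonal they vanish.
  let g : K × K → E →L[ℝ] ℝ := fun p =>
    (d p.1 p.2)⁻¹ • ((ContinuousMap.evalCLM ℝ p.1).comp T - (ContinuousMap.evalCLM ℝ p.2).comp T)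
  have hg : ∀ p a, g p a = (d p.1 p.2)⁻¹ * (T a p.1 - T a p.2) := fun p a => rfl
  obtain ⟨C, hC⟩ := banach_steinhaus (g := g) fun a => by
    obtain ⟨C, hC⟩ := hT a
    refine ⟨|C|, fun p => ?_⟩
    rw [hg, norm_mul, norm_inv, Real.norm_eq_abs, Real.norm_eq_abs, abs_of_nonneg (hd.nonneg _ _)]
    refine inv_mul_le_of_le_mul₀ (hd.nonneg _ _) (abs_nonneg _) ((hC _ _).trans ?_)
    rw [mul_comm]
    exact mul_le_mul_of_nonneg_left (le_abs_self C) (hd.nonneg _ _)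
  refine ⟨max C 1, by positivity, fun a x y => ?_⟩
  rcases eq_or_ne x y with rfl | hxy
  · simp [(hd.eq_zero_iff x x).2 rfl]
  have hpos : 0 < d x y := lt_of_le_of_ne (hd.nonneg x y)
    fun h0 => hxy ((hd.eq_zero_iff x y).1 h0.symm)
  have h1 := (g (x, y)).le_of_opNorm_le ((hC (x, y)).trans (le_max_left C 1)) a
  rwa [hg, norm_mul, norm_inv, Real.norm_eq_abs, Real.norm_eq_abs, abs_of_pos hpos,
    inv_mul_le_iff₀ hpos, mul_comm (d x y)] at h1

universe u

variable {K : Type u} [TopologicalSpace K] [CompactSpace K]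

variable {d : K → K → ℝ}

/-- Call an open `V ⊆ ℝ^ℕ` good if its preimage has a countable net. By second countability the
union of all good sets is good. If it misses part of the image of `K`, take a closed `E ⊆ K` minimal
among those mapping onto that part, and a relatively open piece of `E` of small diameter. By
minimality the rest of `E` no longer maps onto it, so the complement of its image is a further good
set, which is absurd. -/
theorem FragmentedBy.exists_countable_net_of_pos (hfrag : FragmentedBy K d) {f : ℕ → C(K, ℝ)}
    {C : ℝ} (hC : 0 < C) (hf : ∀ n x y, |f n x - f n y| ≤ C * d x y) {ε : ℝ} (hε : 0 < ε) :
    ∃ D : Set K, D.Countable ∧ ∀ x, ∃ y ∈ D, ∀ n, |f n x - f n y| ≤ ε := by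
  let φ : K → ℕ → ℝ := fun x n => f n x
  have hφ : Continuous φ := continuous_pi fun n => (f n).continuous
  let P : Set (ℕ → ℝ) → Prop := fun V =>
    ∃ D : Set K, D.Countable ∧ ∀ x, φ x ∈ V → ∃ y ∈ D, ∀ n, |f n x - f n y| ≤ ε
  let 𝒱 : Set (Set (ℕ → ℝ)) := {V | IsOpen V ∧ P V}
  obtain ⟨𝒲, h𝒲c, h𝒲𝒱, h𝒲⟩ := TopologicalSpace.isOpen_sUnion_countable 𝒱 fun V hV => hV.1
  have hW : P (⋃₀ 𝒱) := by
    choose! D hDc hD using fun V (hV : V ∈ 𝒲) => (h𝒲𝒱 hV).2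
    refine ⟨⋃ V ∈ 𝒲, D V, h𝒲c.biUnion hDc, fun x hx => ?_⟩
    rw [← h𝒲] at hx
    obtain ⟨V, hV, hxV⟩ := hx
    obtain ⟨y, hy, hyx⟩ := hD V hV x hxV
    exact ⟨y, mem_biUnion hV hy, hyx⟩
  have hWo : IsOpen (⋃₀ 𝒱) := isOpen_sUnion fun V hV => hV.1
  suffices hall : ∀ x, φ x ∈ ⋃₀ 𝒱 by
    obtain ⟨D, hDc, hD⟩ := hW
    exact ⟨D, hDc, fun x => hD x (hall x)⟩
  by_contra hne
  push Not at hne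
  obtain ⟨x₀, hx₀⟩ := hne
  let B : Set K := φ ⁻¹' (⋃₀ 𝒱)ᶜ
  have hB : IsClosed B := hWo.isClosed_compl.preimage hφ
  have : CompactSpace B := isCompact_iff_compactSpace.1 hB.isCompact
  -- `ULift` brings the image into the universe of `B`, as the minimality lemma needs.
  let ψ : B → ULift.{u} (φ '' B) := fun x => ⟨φ x, mem_image_of_mem φ x.2⟩
  have hψ : Continuous ψ :=
    continuous_uliftUp.comp ((hφ.comp continuous_subtype_val).subtype_mk _)
  have hψs : Function.Surjective ψ := by
    rintro ⟨⟨_, x, hx, rfl⟩⟩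
    exact ⟨⟨x, hx⟩, rfl⟩
  obtain ⟨E, hEc, hE, hEmin⟩ := exists_compact_surjective_zorn_subset hψ hψs
  have hEne : ((↑) '' E : Set K).Nonempty := by
    have : ψ ⟨x₀, hx₀⟩ ∈ ψ '' E := by rw [hE]; trivial
    obtain ⟨z, hz, -⟩ := this
    exact ⟨z, z, hz, rfl⟩
  obtain ⟨U, hU, ⟨z, ⟨z', hz', rfl⟩, hzU⟩, hdiam⟩ := hfrag _ hEne (ε / C) (by positivity)
  let E₀ : Set E := {x | (x : K) ∉ U}
  have hE₀ : IsClosed E₀ := hU.isClosed_compl.preimage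
    (continuous_subtype_val.comp continuous_subtype_val)
  have hproper := hEmin E₀ (fun h => absurd (h.symm ▸ mem_univ _ : (⟨z', hz'⟩ : E) ∈ E₀)
    (not_not.2 hzU)) hE₀
  let F : Set (ℕ → ℝ) := (fun x : E => φ x) '' E₀
  have hF : IsClosed F := (hE₀.isCompact.image
    (hφ.comp (continuous_subtype_val.comp continuous_subtype_val))).isClosed
  obtain ⟨⟨⟨_, w, hw, rfl⟩⟩, hwF⟩ := (ne_univ_iff_exists_notMem _).1 hproper
  have hwF' : φ w ∉ F := by
    rintro ⟨x, hx, hxw⟩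
    exact hwF ⟨x, hx, ULift.ext _ _ (Subtype.ext hxw)⟩
  refine hw ⟨Fᶜ, ⟨hF.isOpen_compl, ?_⟩, hwF'⟩
  obtain ⟨D, hDc, hD⟩ := hW
  refine ⟨insert ↑z' D, hDc.insert _, fun x hx => ?_⟩
  by_cases hxW : φ x ∈ ⋃₀ 𝒱
  · obtain ⟨y, hy, hyx⟩ := hD x hxW
    exact ⟨y, mem_insert_of_mem _ hy, hyx⟩
  · refine ⟨z', mem_insert _ _, fun n => ?_⟩
    have : ψ ⟨x, hxW⟩ ∈ ψ '' E := by rw [hE]; trivial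
    obtain ⟨y, hyE, hyx⟩ := this
    have hyx' : φ y = φ x := congrArg (fun z => (z.down : ℕ → ℝ)) hyx
    have hyU : (y : K) ∈ U := by
      by_contra hyU
      exact hx (hyx' ▸ ⟨⟨y, hyE⟩, hyU, rfl⟩)
    have hdist : d y z' < ε / C := by
      rw [← ENNReal.ofReal_lt_ofReal_iff (by positivity)]
      refine lt_of_le_of_lt ?_ hdiam
      exact le_iSup₂_of_le (y : K) ⟨⟨y, hyE, rfl⟩, hyU⟩
        (le_iSup₂_of_le (z' : K) ⟨⟨z', hz', rfl⟩, hzU⟩ le_rfl)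
    have : f n x = f n y := (congrFun hyx' n).symm
    rw [this]
    refine (hf n y z').trans ?_
    rw [lt_div_iff₀ hC] at hdist
    linarith

/-- Extract a subsequence converging on the countable union of the `1 / (k + 1)`-nets; uniformity in
`n` of the approximation carries the Cauchy property to every point. -/
theorem FragmentedBy.exists_subseq_tendsto (hfrag : FragmentedBy K d) {f : ℕ → C(K, ℝ)}
    {C : ℝ} (hC : 0 < C) (hf : ∀ n x y, |f n x - f n y| ≤ C * d x y) {M : ℝ}
    (hM : ∀ n, ‖f n‖ ≤ M) :
    ∃ φ : ℕ → ℕ, StrictMono φ ∧ ∀ x, ∃ l, Tendsto (fun n => f (φ n) x) atTop (𝓝 l) := by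
  choose D hDc hD using fun k : ℕ =>
    hfrag.exists_countable_net_of_pos hC hf (Nat.one_div_pos_of_nat (n := k) (α := ℝ))
  let S : Set K := ⋃ k, D k
  have : Countable S := (countable_iUnion hDc).to_subtype
  have hcomp : IsCompact (univ.pi fun _ : S => Icc (-M) M) := isCompact_univ_pi fun _ => isCompact_Icc
  obtain ⟨l, -, φ, hφ, hl⟩ := hcomp.tendsto_subseq (x := fun n (s : S) => f n s)
    fun n s _ => abs_le.1 (((f n).norm_coe_le_norm s).trans (hM n))
  refine ⟨φ, hφ, fun x => cauchySeq_tendsto_of_complete ?_⟩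
  rw [Metric.cauchySeq_iff]
  intro ε hε
  obtain ⟨k, hk⟩ := exists_nat_one_div_lt (show 0 < ε / 3 by linarith)
  obtain ⟨y, hy, hyx⟩ := hD k x
  have hcy : CauchySeq fun n => f (φ n) y :=
    ((tendsto_pi_nhds.1 hl) ⟨y, mem_iUnion.2 ⟨k, hy⟩⟩).cauchySeq
  obtain ⟨N, hN⟩ := Metric.cauchySeq_iff.1 hcy (ε / 3) (by linarith)
  refine ⟨N, fun m hm n hn => ?_⟩
  have h1 := hN m hm n hn
  have h2 := hyx (φ m)
  have h3 := hyx (φ n)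
  rw [Real.dist_eq] at h1 ⊢
  rw [abs_lt] at h1 ⊢
  rw [abs_le] at h2 h3
  constructor <;> linarith [h1.1, h1.2, h2.1, h2.2, h3.1, h3.2]

variable [T2Space K]

/-- A positive functional on `C(K)` sends bounded pointwise null sequences to null sequences. -/
theorem tendsto_positive_functional_of_pointwise (Λ : C(K, ℝ) →ₗ[ℝ] ℝ)
    (hΛ : ∀ h : C(K, ℝ), (∀ x, 0 ≤ h x) → 0 ≤ Λ h) {h : ℕ → C(K, ℝ)} {M : ℝ}
    (hM : ∀ n x, |h n x| ≤ M) (hlim : ∀ x, Tendsto (fun n => h n x) atTop (𝓝 0)) :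
    Tendsto (fun n => Λ (h n)) atTop (𝓝 0) := by
  let _ : MeasurableSpace K := borel K
  have : BorelSpace K := ⟨rfl⟩
  let Φ : CompactlySupportedContinuousMap K ℝ →ₚ[ℝ] ℝ := PositiveLinearMap.mk₀
    { toFun := fun f => Λ f.toContinuousMap
      map_add' := fun f g => Λ.map_add f.toContinuousMap g.toContinuousMap
      map_smul' := fun c f => Λ.map_smul c f.toContinuousMap } fun f hf => hΛ _ hf
  let μ := RealRMK.rieszMeasure Φ
  have hint : ∀ g : C(K, ℝ), ∫ x, g x ∂μ = Λ g := fun g =>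
    RealRMK.integral_rieszMeasure Φ (CompactlySupportedContinuousMap.continuousMapEquiv g)
  have : IsFiniteMeasure μ := inferInstanceAs (IsFiniteMeasure (RealRMK.rieszMeasure Φ))
  simp only [← hint]
  have := tendsto_integral_of_dominated_convergence (μ := μ) (F := fun n x => h n x)
    (f := fun _ => 0) (fun _ => M) (fun n => (h n).continuous.aestronglyMeasurable)
    (integrable_const M) (fun n => Eventually.of_forall (hM n)) (Eventually.of_forall hlim)
  simpa using this

/-- A sequence whose images under an embedding of normed spaces into `C(K)` form a pointwise null bounded
sequence cannot lie on an affine hyperplane `Ψ = 1`. -/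
theorem not_pointwise_null_of_embedding {E : Type*} [NormedAddCommGroup E] [NormedSpace ℝ E]
    (T : E →L[ℝ] C(K, ℝ)) {c : ℝ} (hc : 0 < c) (hT : ∀ a, c * ‖a‖ ≤ ‖T a‖) (Ψ : E →L[ℝ] ℝ)
    (hΨ : ∀ a, ‖Ψ a‖ ≤ ‖a‖) {u : ℕ → E} (hu : ∀ n, Ψ (u n) = 1) {M : ℝ}
    (hM : ∀ n, ‖T (u n)‖ ≤ M) (hlim : ∀ x, Tendsto (fun n => T (u n) x) atTop (𝓝 0)) : False := by
  let s : Set C(K, ℝ) := {h | ∀ x, h x < c}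
  -- Passing to dominating functions `h` makes the separating functional positive, so that a
  -- positive measure suffices.
  let t : Set C(K, ℝ) := {h | ∃ a, Ψ a = 1 ∧ ∀ x, |T a x| ≤ h x}
  have hs : Convex ℝ s := by
    intro f hf g hg α β hα hβ hαβ x
    exact convex_Iio c (hf x) (hg x) hα hβ hαβ
  have hso : IsOpen s := by
    have := ContinuousMap.isOpen_setOfPred_mapsTo (isCompact_univ (X := K)) (isOpen_Iio (a := c))
    simpa [MapsTo] using this
  have ht : Convex ℝ t := by
    rintro f ⟨a, ha, haf⟩ g ⟨b, hb, hbg⟩ α β hα hβ hαβ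
    refine ⟨α • a + β • b, by simp [ha, hb, hαβ], fun x => ?_⟩
    simp only [map_add, map_smul, ContinuousMap.add_apply, ContinuousMap.smul_apply, smul_eq_mul]
    refine (abs_add_le _ _).trans (add_le_add ?_ ?_)
    · rw [abs_mul, abs_of_nonneg hα]
      exact mul_le_mul_of_nonneg_left (haf x) hα
    · rw [abs_mul, abs_of_nonneg hβ]
      exact mul_le_mul_of_nonneg_left (hbg x) hβ
  have hdisj : Disjoint s t := by
    rw [Set.disjoint_left]
    rintro h hs ⟨a, ha, hah⟩
    have h1 : 1 ≤ ‖a‖ := by simpa [ha] using hΨ a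
    have h2 : ‖T a‖ < c := (ContinuousMap.norm_lt_iff _ hc).2 fun x => (hah x).trans_lt (hs x)
    nlinarith [hT a]
  obtain ⟨Λ, r, hΛs, hΛt⟩ := geometric_hahn_banach_open hs hso ht hdisj
  have hr : 0 < r := by simpa using hΛs 0 fun x => by simpa using hc
  have hpos : ∀ h : C(K, ℝ), (∀ x, 0 ≤ h x) → 0 ≤ Λ h := by
    intro h hh
    by_contra hneg
    obtain ⟨n, hn⟩ := Archimedean.arch r (neg_pos.2 (not_le.1 hneg))
    -- Every `-(n • h)` lies in `s`, on which `Λ` stays below `r`.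
    have h1 := hΛs (-(n • h)) fun x => by
      have : 0 ≤ (n : ℝ) * h x := mul_nonneg n.cast_nonneg (hh x)
      rw [ContinuousMap.neg_apply, ContinuousMap.smul_apply, nsmul_eq_mul]
      linarith
    rw [map_neg, map_nsmul, ← smul_neg] at h1
    exact absurd hn (not_le.2 h1)
  have hlim' := tendsto_positive_functional_of_pointwise Λ.toLinearMap hpos
    (h := fun n => |T (u n)|) (M := M)
    (fun n x => by
      rw [ContinuousMap.abs_apply, abs_abs]
      exact ((T (u n)).norm_coe_le_norm x).trans (hM n))
    (fun x => by simpa using (hlim x).abs)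
  exact absurd (ge_of_tendsto' hlim' fun n => hΛt _ ⟨u n, hu n, fun x => le_rfl⟩) (not_le.2 hr)

theorem not_fragmentedBy_of_containsIsomorphicLipschitzCopy (hd : IsMetricOn d)
    (h : ContainsIsomorphicLipschitzCopy K d EllOne) : ¬ FragmentedBy K d := by
  intro hfrag
  obtain ⟨X, hX, ⟨e⟩⟩ := h
  let T : EllOne →L[ℝ] C(K, ℝ) := X.subtypeL.comp (e : EllOne →L[ℝ] X)
  obtain ⟨C, hC0, hC⟩ := exists_uniform_lipschitz_constant hd T fun a => hX _ (e a).2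
  let b : ℕ → EllOne := fun n => lp.single 1 n (1 : ℝ)
  have hb : ∀ n, ‖b n‖ = 1 := fun n => by
    simp [b, lp.norm_single]
  obtain ⟨φ, hφ, hlim⟩ := hfrag.exists_subseq_tendsto (f := fun n => T (b n)) hC0
    (fun n x y => by simpa [hb] using hC (b n) x y) (M := ‖T‖)
    (fun n => by simpa [hb] using T.le_opNorm (b n))
  classical
  -- The functional with coefficients `v` sees only the even terms of the subsequence, so it equals
  -- `1` on each difference `u k`.
  let v : ℕ → ℝ := fun n => if n ∈ range (fun k => φ (2 * k)) then 1 else 0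
  have hv : ∀ n, ‖v n‖ ≤ 1 := fun n => by
    by_cases hn : n ∈ range (fun k => φ (2 * k)) <;> simp only [v, hn] <;> simp
  have hodd : ∀ k, φ (2 * k + 1) ∉ range (fun k => φ (2 * k)) := by
    rintro k ⟨j, hj⟩
    have := hφ.injective hj
    omega
  let u : ℕ → EllOne := fun k => b (φ (2 * k)) - b (φ (2 * k + 1))
  obtain ⟨c, hc0, hc⟩ : ∃ c : ℝ, 0 < c ∧ ∀ a, c * ‖a‖ ≤ ‖T a‖ := by
    obtain ⟨κ, hκ⟩ := T.antilipschitz_of_isEmbedding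
      (IsEmbedding.subtypeVal.comp e.toHomeomorph.isEmbedding)
    have hκ0 : (0 : ℝ) < κ + 1 := by positivity
    refine ⟨_, inv_pos.2 hκ0, fun a => ?_⟩
    rw [inv_mul_le_iff₀ hκ0]
    refine (ZeroHomClass.bound_of_antilipschitz T hκ a).trans ?_
    exact mul_le_mul_of_nonneg_right (by linarith) (norm_nonneg _)
  refine not_pointwise_null_of_embedding T hc0 hc (EllOne.sumCLM v hv)
    (EllOne.norm_sumCLM_le hv) (u := u) (fun k => ?_) (M := ‖T‖ * 2) (fun k => ?_) fun x => ?_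
  · simp only [u, b, map_sub, EllOne.sumCLM_single]
    simp only [v, hodd, mem_range_self, if_true, if_false, sub_zero]
  · refine (T.le_opNorm _).trans (mul_le_mul_of_nonneg_left ?_ (norm_nonneg _))
    refine (norm_sub_le _ _).trans ?_
    rw [hb, hb]
    norm_num
  · obtain ⟨l, hl⟩ := hlim x
    have h1 : Tendsto (fun k : ℕ => 2 * k) atTop atTop :=
      tendsto_id.const_mul_atTop' two_pos
    have h2 : Tendsto (fun k : ℕ => 2 * k + 1) atTop atTop :=
      tendsto_atTop_mono (fun k => Nat.le_succ _) h1
    simpa [u] using (hl.comp h1).sub (hl.comp h2)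

end Fragmented

theorem theorem5p5 {K : Type*} [TopologicalSpace K] [CompactSpace K] [T2Space K]
    (d : K → K → ℝ) (hd : IsMetricOn d)
    (hlsc : LowerSemicontinuous (fun p : K × K => d p.1 p.2)) :
    List.TFAE
      [¬ FragmentedBy K d,
        ContainsIsometricLipschitzCopy K d EllOne,
        ContainsIsomorphicLipschitzCopy K d EllOne] := by
  tfae_have 1 → 2 := containsIsometricLipschitzCopy_of_not_fragmentedBy hd hlsc
  tfae_have 2 → 3 := fun ⟨X, hX, ⟨e⟩⟩ => ⟨X, hX, ⟨e.toContinuousLinearEquiv⟩⟩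
  tfae_have 3 → 1 := not_fragmentedBy_of_containsIsomorphicLipschitzCopy hd
  tfae_finish
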